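/- Let $K$ be a field, let $(x_{ij})$ be an $m\times n$ matrix of indeterminates and $S=K[x_{ij} : 1\le i\le m,\ 1\le j\le n]$ with its standard grading. A $2$-minor $\delta=[a_1,a_2|b_1,b_2]$ (rows $a_1<a_2$, columns $b_1<b_2$) is a *corner-interval minor* if $b_1=1$; its vertices are the four variables $x_{a_kb_l}$, its horizontal edges are $\{x_{a_kb_1},x_{a_kb_2}\}$ and its vertical edges are $\{x_{a_1b_l},x_{a_2b_l}\}$ ($k,l\in\{1,2\}$). For a set $\mathcal C$ of corner-interval minors let $V(\mathcal C)$ be the set of all vertices of its members and $$I(\mathcal C)=(x_{a_1b_1}x_{a_2b_2}-x_{a_1b_2}x_{a_2b_1} : [a_1,a_2|b_1,b_2]\in\mathcal C)\subset S.$$ A *vertical* (resp. *horizontal*) *interval* of $\mathcal C$ is a nonempty set of elements of $V(\mathcal C)$ in one column (resp. one row), any two of which are connected by a path of vertical (resp. horizontal) edges of members of $\mathcal C$; it is *maximal* if it is not strictly contained in another vertical (resp. horizontal) interval. For a finitely generated graded $S$-module $N$, $\beta_{ij}(N)$ denotes the number of summands $S(-j)$ in the $i$-th free module of a minimal graded free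 resolution of $N$ over $S$. **Proposition.** Let $\mathcal C$ be an arbitrary set of corner-interval minors, let $H$ be a maximal vertical or a maximal horizontal interval of $\mathcal C$, and let $\mathcal C'=\{\delta\in\mathcal C : \delta \text{ has no vertex in } H\}$. Then for all $t\ge 1$ the modules $S/I(\mathcal C)^t$ and $S/I(\mathcal C')^t$ have minimal graded free resolutions over $S$, and $$\beta_{ij}(S/I(\mathcal C')^t)\le\beta_{ij}(S/I(\mathcal C)^t)\qquad\text{for all } i,j\ge 0.$$ -/

import Mathlib

/-! ### Two-minors of a generic matrix -/

/-- The index `[a₁, a₂ | b₁, b₂]` of a `2`-minor of an `m × n` matrix: rows `a₁ < a₂`,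
columns `b₁ < b₂` (rows and columns are numbered from `0`). -/
structure TwoMinor (m n : ℕ) where
  a₁ : Fin m
  a₂ : Fin m
  b₁ : Fin n
  b₂ : Fin n
  row_lt : a₁ < a₂
  col_lt : b₁ < b₂

namespace TwoMinor

variable {m n : ℕ}

/-- A corner-interval minor uses the first column. -/
def IsCornerInterval (δ : TwoMinor m n) : Prop := (δ.b₁ : ℕ) = 0

/-- The four vertices of a minor; the variable `x_{ij}` is represented by its index `(i, j)`. -/
def vertices (δ : TwoMinor m n) : Set (Fin m × Fin n) :=
  {(δ.a₁, δ.b₁), (δ.a₁, δ.b₂), (δ.a₂, δ.b₁), (δ.a₂, δ.b₂)}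

/-- The edges joining two vertices in the same row. -/
def horizontalEdges (δ : TwoMinor m n) : Set (Sym2 (Fin m × Fin n)) :=
  {s((δ.a₁, δ.b₁), (δ.a₁, δ.b₂)), s((δ.a₂, δ.b₁), (δ.a₂, δ.b₂))}

/-- The edges joining two vertices in the same column. -/
def verticalEdges (δ : TwoMinor m n) : Set (Sym2 (Fin m × Fin n)) :=
  {s((δ.a₁, δ.b₁), (δ.a₂, δ.b₁)), s((δ.a₁, δ.b₂), (δ.a₂, δ.b₂))}

/-- The binomial `x_{a₁b₁} x_{a₂b₂} - x_{a₁b₂} x_{a₂b₁}`. -/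
noncomputable def binomial (K : Type*) [Field K] (δ : TwoMinor m n) :
    MvPolynomial (Fin m × Fin n) K :=
  MvPolynomial.X (δ.a₁, δ.b₁) * MvPolynomial.X (δ.a₂, δ.b₂)
    - MvPolynomial.X (δ.a₁, δ.b₂) * MvPolynomial.X (δ.a₂, δ.b₁)

/-- The vertex set `V(𝒞)` of a set of minors. -/
def vertexSet (C : Set (TwoMinor m n)) : Set (Fin m × Fin n) := ⋃ δ ∈ C, δ.vertices

/-- The graph whose edges are the horizontal edges of `𝒞`. -/
def horizontalGraph (C : Set (TwoMinor m n)) : SimpleGraph (Fin m × Fin n) :=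
  SimpleGraph.fromEdgeSet (⋃ δ ∈ C, δ.horizontalEdges)

/-- The graph whose edges are the vertical edges of `𝒞`. -/
def verticalGraph (C : Set (TwoMinor m n)) : SimpleGraph (Fin m × Fin n) :=
  SimpleGraph.fromEdgeSet (⋃ δ ∈ C, δ.verticalEdges)

/-- A nonempty set of vertices of `𝒞` in one row, any two of which are connected by a sequence
of horizontal edges of `𝒞`. -/
def IsHorizontalInterval (C : Set (TwoMinor m n)) (U : Set (Fin m × Fin n)) : Prop :=
  U.Nonempty ∧ U ⊆ vertexSet C ∧ (∃ i, ∀ p ∈ U, p.1 = i) ∧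
    ∀ p ∈ U, ∀ q ∈ U, (horizontalGraph C).Reachable p q

/-- A nonempty set of vertices of `𝒞` in one column, any two of which are connected by a sequence
of vertical edges of `𝒞`. -/
def IsVerticalInterval (C : Set (TwoMinor m n)) (U : Set (Fin m × Fin n)) : Prop :=
  U.Nonempty ∧ U ⊆ vertexSet C ∧ (∃ j, ∀ p ∈ U, p.2 = j) ∧
    ∀ p ∈ U, ∀ q ∈ U, (verticalGraph C).Reachable p q

/-- A horizontal interval of `𝒞` not strictly contained in another one. -/
def IsMaximalHorizontalInterval (C : Set (TwoMinor m n)) (U : Set (Fin m × Fin n)) : Prop :=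
  Maximal (IsHorizontalInterval C) U

/-- A vertical interval of `𝒞` not strictly contained in another one. -/
def IsMaximalVerticalInterval (C : Set (TwoMinor m n)) (U : Set (Fin m × Fin n)) : Prop :=
  Maximal (IsVerticalInterval C) U

/-- `𝒞 \ U`: the minors in `𝒞` none of whose vertices lies in `U`. -/
def removeVertices (C : Set (TwoMinor m n)) (U : Set (Fin m × Fin n)) : Set (TwoMinor m n) :=
  {δ ∈ C | Disjoint δ.vertices U}

/-- The binomial ideal `I(𝒞)` of `S = K[x_{ij} : i ∈ [m], j ∈ [n]]`. -/
noncomputable def binomialIdeal (K : Type*) [Field K] (C : Set (TwoMinor m n)) :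
    Ideal (MvPolynomial (Fin m × Fin n) K) :=
  Ideal.span ((fun δ => δ.binomial K) '' C)

end TwoMinor

/-! ### Minimal graded free resolutions and graded Betti numbers -/

/-- `v` lies in the degree `e` part of `⨁ l, S(-deg l)`, that is, `v l ∈ S_{e - deg l}` for every
`l`. -/
def IsHomogeneousVector {σ K : Type*} [Field K] {r : ℕ} (deg : Fin r → ℕ) (e : ℕ)
    (v : Fin r → MvPolynomial σ K) : Prop :=
  ∀ l, ∀ s : σ →₀ ℕ, MvPolynomial.coeff s (v l) ≠ 0 → s.degree + deg l = e

/-- A minimal graded free resolution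
`⋯ ⟶ ⨁ k, S(-deg 1 k) ⟶ ⨁ k, S(-deg 0 k) ⟶ M ⟶ 0` of a graded module `M = ⨁ ℳ e` over the
standard graded polynomial ring `S = K[x_s : s ∈ σ]`, by finitely generated free modules. -/
structure MinimalGradedFreeResolution {σ K : Type*} [Field K] {M : Type*} [AddCommGroup M]
    [Module (MvPolynomial σ K) M] [Module K M] (ℳ : ℕ → Submodule K M) where
  /-- the rank of the `i`-th free module -/
  rank : ℕ → ℕ
  /-- the degrees of the basis elements of the `i`-th free module -/
  deg : (i : ℕ) → Fin (rank i) → ℕ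
  /-- the differentials -/
  d : (i : ℕ) → (Fin (rank (i + 1)) → MvPolynomial σ K) →ₗ[MvPolynomial σ K]
    (Fin (rank i) → MvPolynomial σ K)
  /-- the augmentation -/
  ε : (Fin (rank 0) → MvPolynomial σ K) →ₗ[MvPolynomial σ K] M
  d_graded : ∀ i e v, IsHomogeneousVector (deg (i + 1)) e v →
    IsHomogeneousVector (deg i) e (d i v)
  ε_graded : ∀ e v, IsHomogeneousVector (deg 0) e v → ε v ∈ ℳ e
  ε_surjective : Function.Surjective ε
  exact_zero : Function.Exact (d 0) ε
  exact_succ : ∀ i, Function.Exact (d (i + 1)) (d i)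
  /-- the image of each differential lies in `𝔪 F_i`, where `𝔪 = (x_s : s ∈ σ)` -/
  minimal : ∀ i v l, MvPolynomial.constantCoeff (d i v l) = 0

/-- The graded Betti number `β_{i,j}`: the number of summands `S(-j)` of the `i`-th free module of
a minimal graded free resolution. -/
def MinimalGradedFreeResolution.betti {σ K : Type*} [Field K] {M : Type*} [AddCommGroup M]
    [Module (MvPolynomial σ K) M] [Module K M] {ℳ : ℕ → Submodule K M}
    (F : MinimalGradedFreeResolution (σ := σ) ℳ) (i j : ℕ) : ℕ :=
  (Finset.univ.filter (fun k => F.deg i k = j)).card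

/-- The standard grading of `S / J`: the degree `e` part is the image of `S_e`. -/
noncomputable def quotientGrading {σ K : Type*} [Field K] (J : Ideal (MvPolynomial σ K)) (e : ℕ) :
    Submodule K (MvPolynomial σ K ⧸ J) :=
  (MvPolynomial.homogeneousSubmodule σ K e).map (Ideal.Quotient.mkₐ K J).toLinearMap

/-! ### Existence of minimal graded free resolutions -/

namespace GradedFreeAux

open MvPolynomial

variable {σ K : Type*} [Field K]

/-- The degree `e` component of a vector in `⨁ l, S(-deg l)`. -/
noncomputable def comp {r : ℕ} (deg : Fin r → ℕ) (e : ℕ) :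
    (Fin r → MvPolynomial σ K) →ₗ[K] (Fin r → MvPolynomial σ K) :=
  LinearMap.pi fun l =>
    if deg l ≤ e then (homogeneousComponent (e - deg l)).comp (LinearMap.proj l) else 0

theorem coeff_comp {r : ℕ} (deg : Fin r → ℕ) (e : ℕ) (v : Fin r → MvPolynomial σ K) (l : Fin r)
    (s : σ →₀ ℕ) :
    coeff s (comp deg e v l) = if s.degree + deg l = e then coeff s (v l) else 0 := by
  unfold comp
  rw [LinearMap.pi_apply]
  split_ifs with h1 h2 h2
  · simp only [LinearMap.comp_apply, LinearMap.proj_apply, coeff_homogeneousComponent]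
    rw [if_pos (by omega)]
  · simp only [LinearMap.comp_apply, LinearMap.proj_apply, coeff_homogeneousComponent]
    rw [if_neg (by omega)]
  · omega
  · simp

theorem comp_isHomogeneousVector {r : ℕ} (deg : Fin r → ℕ) (e : ℕ)
    (v : Fin r → MvPolynomial σ K) : IsHomogeneousVector deg e (comp deg e v) := by
  intro l s hs
  rw [coeff_comp] at hs
  by_contra h
  exact hs (if_neg h)

theorem comp_of_homogeneous {r : ℕ} {deg : Fin r → ℕ} {e : ℕ} {v : Fin r → MvPolynomial σ K}
    (hv : IsHomogeneousVector deg e v) (e' : ℕ) :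
    comp deg e' v = if e = e' then v else 0 := by
  funext l
  ext s
  rw [coeff_comp]
  by_cases hs : coeff s (v l) = 0
  · split_ifs <;> simp [hs]
  · have := hv l s hs
    subst this
    split_ifs <;> simp

theorem sum_comp {r : ℕ} (deg : Fin r → ℕ) (v : Fin r → MvPolynomial σ K) :
    ∃ T : Finset ℕ, v = ∑ e ∈ T, comp deg e v := by
  refine ⟨Finset.univ.biUnion fun l => (v l).support.image fun s => s.degree + deg l, ?_⟩
  funext l
  ext s
  rw [Finset.sum_apply, coeff_sum]
  simp only [coeff_comp, Finset.sum_ite_eq]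
  split_ifs with h
  · rfl
  · by_contra hs
    apply h
    simp only [Finset.mem_biUnion, Finset.mem_univ, true_and, Finset.mem_image, mem_support_iff]
    exact ⟨l, s, hs, rfl⟩

/-- Submodules of `⨁ l, S(-deg l)` closed under taking components. -/
def IsHomogeneousSubmodule {r : ℕ} (deg : Fin r → ℕ)
    (N : Submodule (MvPolynomial σ K) (Fin r → MvPolynomial σ K)) : Prop :=
  ∀ v ∈ N, ∀ e, comp deg e v ∈ N

theorem comp_map {r r' : ℕ} {deg : Fin r → ℕ} {deg' : Fin r' → ℕ}
    (f : (Fin r' → MvPolynomial σ K) →ₗ[MvPolynomial σ K] (Fin r → MvPolynomial σ K))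
    (hf : ∀ e v, IsHomogeneousVector deg' e v → IsHomogeneousVector deg e (f v))
    (e : ℕ) (v : Fin r' → MvPolynomial σ K) : comp deg e (f v) = f (comp deg' e v) := by
  obtain ⟨T, hT⟩ := sum_comp deg' v
  have h1 : ∀ w : Fin r' → MvPolynomial σ K, ∀ e', comp deg e (f (comp deg' e' w)) =
      f (comp deg' e (comp deg' e' w)) := by
    intro w e'
    rw [comp_of_homogeneous (hf e' _ (comp_isHomogeneousVector deg' e' w)),
      comp_of_homogeneous (comp_isHomogeneousVector deg' e' w)]
    split_ifs <;> simp
  rw [hT]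
  simp only [map_sum, h1]

theorem exists_generators [Finite σ] {r : ℕ} (deg : Fin r → ℕ)
    (N : Submodule (MvPolynomial σ K) (Fin r → MvPolynomial σ K))
    (hN : IsHomogeneousSubmodule deg N) :
    ∃ (k : ℕ) (deg' : Fin k → ℕ) (g : Fin k → Fin r → MvPolynomial σ K),
      (∀ l, IsHomogeneousVector deg (deg' l) (g l)) ∧
        Submodule.span (MvPolynomial σ K) (Set.range g) = N := by
  classical
  obtain ⟨G, hG⟩ := IsNoetherian.noetherian N
  choose T hT using fun v : Fin r → MvPolynomial σ K => sum_comp deg v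
  let A : Finset (ℕ × (Fin r → MvPolynomial σ K)) :=
    G.biUnion fun v => (T v).image fun e => (e, comp deg e v)
  have hA : ∀ x ∈ A, IsHomogeneousVector deg x.1 x.2 ∧ x.2 ∈ N := by
    intro x hx
    simp only [A, Finset.mem_biUnion, Finset.mem_image] at hx
    obtain ⟨v, hv, e, _, rfl⟩ := hx
    exact ⟨comp_isHomogeneousVector deg e v, hN v (hG ▸ Submodule.subset_span hv) e⟩
  refine ⟨A.card, fun l => (A.equivFin.symm l).1.1, fun l => (A.equivFin.symm l).1.2,
    fun l => (hA _ (A.equivFin.symm l).2).1, le_antisymm ?_ ?_⟩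
  · rw [Submodule.span_le]
    rintro _ ⟨l, rfl⟩
    exact (hA _ (A.equivFin.symm l).2).2
  · rw [← hG, Submodule.span_le]
    intro v hv
    rw [SetLike.mem_coe, hT v]
    refine Submodule.sum_mem _ fun e he => Submodule.subset_span ?_
    have hm : (e, comp deg e v) ∈ A := by
      simp only [A, Finset.mem_biUnion, Finset.mem_image]
      exact ⟨v, hv, e, he, rfl⟩
    exact ⟨A.equivFin ⟨_, hm⟩, by simp⟩

theorem exists_cover [Finite σ] {r : ℕ} (deg : Fin r → ℕ)
    (N : Submodule (MvPolynomial σ K) (Fin r → MvPolynomial σ K))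
    (hN : IsHomogeneousSubmodule deg N) :
    ∃ (k : ℕ) (deg' : Fin k → ℕ)
      (f : (Fin k → MvPolynomial σ K) →ₗ[MvPolynomial σ K] (Fin r → MvPolynomial σ K)),
      (∀ e v, IsHomogeneousVector deg' e v → IsHomogeneousVector deg e (f v)) ∧
      LinearMap.range f = N ∧
      IsHomogeneousSubmodule deg' (LinearMap.ker f) ∧
      ∀ v ∈ LinearMap.ker f, ∀ l, constantCoeff (v l) = 0 := by
  classical
  have hex := exists_generators deg N hN
  obtain ⟨deg', g, hg, hspan⟩ := Nat.find_spec hex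
  have hmin := fun k (hk : k < Nat.find hex) => Nat.find_min hex hk
  generalize Nat.find hex = k at deg' g hg hspan hmin
  let f := Fintype.linearCombination (MvPolynomial σ K) g
  have hf : ∀ e v, IsHomogeneousVector deg' e v → IsHomogeneousVector deg e (f v) := by
    intro e v hv l s hs
    simp only [f, Fintype.linearCombination_apply, Finset.sum_apply, Pi.smul_apply, smul_eq_mul,
      coeff_sum] at hs
    obtain ⟨i, _, hi⟩ := Finset.exists_ne_zero_of_sum_ne_zero hs
    rw [coeff_mul] at hi
    obtain ⟨⟨p, q⟩, hpq, hne⟩ := Finset.exists_ne_zero_of_sum_ne_zero hi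
    have h1 := hv i p (left_ne_zero_of_mul hne)
    have h2 := hg i l q (right_ne_zero_of_mul hne)
    have hpq : p + q = s := by simpa using hpq
    rw [← hpq, map_add]
    omega
  have hker : IsHomogeneousSubmodule deg' (LinearMap.ker f) := by
    intro v hv e
    rw [LinearMap.mem_ker] at hv ⊢
    rw [← comp_map f hf, hv, map_zero]
  refine ⟨k, deg', f, hf, ?_, hker, ?_⟩
  · rw [← hspan]
    exact Fintype.range_linearCombination _ g
  · intro v hv l
    by_contra hc
    have hw := hker v hv (deg' l)
    set w := comp deg' (deg' l) v with hwdef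
    have hwl : w l = C (constantCoeff (v l)) := by
      ext s
      rw [hwdef, coeff_comp, coeff_C]
      by_cases hs : s = 0
      · subst hs
        simp [constantCoeff_eq]
      · have : s.degree ≠ 0 := fun h => hs ((Finsupp.degree_eq_zero_iff s).1 h)
        rw [if_neg (by omega), if_neg (Ne.symm hs)]
    rw [LinearMap.mem_ker] at hw
    simp only [f, Fintype.linearCombination_apply] at hw
    obtain _ | k := k
    · exact l.elim0
    rw [Fin.sum_univ_succAbove _ l, hwl] at hw
    refine hmin k (Nat.lt_succ_self k)
      ⟨fun i => deg' (l.succAbove i), fun i => g (l.succAbove i), fun i => hg _, ?_⟩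
    rw [← hspan]
    apply le_antisymm
    · apply Submodule.span_mono
      rintro _ ⟨i, rfl⟩
      exact ⟨_, rfl⟩
    · rw [Submodule.span_le]
      rintro _ ⟨i, rfl⟩
      rw [SetLike.mem_coe]
      obtain rfl | ⟨i, rfl⟩ := Fin.eq_self_or_eq_succAbove l i
      · have h2 : g i = (C (constantCoeff (v i))⁻¹ : MvPolynomial σ K) •
            ((C (constantCoeff (v i)) : MvPolynomial σ K) • g i) := by
          rw [smul_smul, ← C_mul, inv_mul_cancel₀ hc, C_1, one_smul]
        rw [h2, eq_neg_of_add_eq_zero_left hw]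
        exact Submodule.smul_mem _ _ (Submodule.neg_mem _ (Submodule.sum_mem _ fun j _ =>
          Submodule.smul_mem _ _ (Submodule.subset_span ⟨j, rfl⟩)))
      · exact Submodule.subset_span ⟨i, rfl⟩

/-- A graded free module with a homogeneous submodule. -/
structure State (σ K : Type*) [Field K] where
  r : ℕ
  deg : Fin r → ℕ
  N : Submodule (MvPolynomial σ K) (Fin r → MvPolynomial σ K)
  hN : IsHomogeneousSubmodule deg N

theorem exists_step [Finite σ] (s : State σ K) : ∃ (s' : State σ K)
    (f : (Fin s'.r → MvPolynomial σ K) →ₗ[MvPolynomial σ K] (Fin s.r → MvPolynomial σ K)),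
      (∀ e v, IsHomogeneousVector s'.deg e v → IsHomogeneousVector s.deg e (f v)) ∧
      LinearMap.range f = s.N ∧ LinearMap.ker f = s'.N ∧
      ∀ v ∈ s'.N, ∀ l, constantCoeff (v l) = 0 := by
  obtain ⟨k, deg', f, h1, h2, h3, h4⟩ := exists_cover s.deg s.N s.hN
  exact ⟨⟨k, deg', LinearMap.ker f, h3⟩, f, h1, h2, rfl, h4⟩

theorem exists_resolution [Finite σ] {M : Type*} [AddCommGroup M] [Module (MvPolynomial σ K) M]
    [Module K M] (ℳ : ℕ → Submodule K M) (s : State σ K)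
    (ε : (Fin s.r → MvPolynomial σ K) →ₗ[MvPolynomial σ K] M)
    (h1 : ∀ e v, IsHomogeneousVector s.deg e v → ε v ∈ ℳ e) (h2 : Function.Surjective ε)
    (h3 : LinearMap.ker ε = s.N) (h4 : ∀ v ∈ s.N, ∀ l, constantCoeff (v l) = 0) :
    Nonempty (MinimalGradedFreeResolution (σ := σ) ℳ) := by
  choose nxt f hgr hrange hker hmin using exists_step (σ := σ) (K := K)
  let st : ℕ → State σ K := fun i => Nat.rec s (fun _ => nxt) i
  have hst : ∀ i, ∀ v ∈ (st i).N, ∀ l, constantCoeff (v l) = 0 := by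
    intro i
    cases i with
    | zero => exact h4
    | succ i => exact hmin (st i)
  exact ⟨{
    rank := fun i => (st i).r
    deg := fun i => (st i).deg
    d := fun i => f (st i)
    ε := ε
    d_graded := fun i => hgr (st i)
    ε_graded := h1
    ε_surjective := h2
    exact_zero := LinearMap.exact_iff.2 (h3.trans (hrange s).symm)
    exact_succ := fun i => LinearMap.exact_iff.2 ((hker (st i)).trans (hrange (st (i + 1))).symm)
    minimal := fun i v l => hst i _ (hrange (st i) ▸ LinearMap.mem_range_self (f (st i)) v) l }⟩

end GradedFreeAux

open MvPolynomial GradedFreeAux in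
/-- The quotient of a polynomial ring in finitely many variables by a homogeneous ideal has a
minimal graded free resolution. -/
theorem nonempty_minimalGradedFreeResolution {σ K : Type*} [Finite σ] [Field K]
    (J : Ideal (MvPolynomial σ K)) (hcomp : ∀ x ∈ J, ∀ e, homogeneousComponent e x ∈ J) :
    Nonempty (MinimalGradedFreeResolution (σ := σ) (quotientGrading J)) := by
  by_cases hT : J = ⊤
  · subst hT
    have : Subsingleton (MvPolynomial σ K ⧸ (⊤ : Ideal (MvPolynomial σ K))) :=
      Ideal.Quotient.subsingleton_iff.2 rfl
    refine exists_resolution _ ⟨0, Fin.elim0, ⊤, fun _ _ _ => trivial⟩ 0 ?_ ?_ ?_ ?_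
    · intro e v _
      simp
    · intro y
      exact ⟨0, Subsingleton.elim _ _⟩
    · exact LinearMap.ker_zero
    · intro v _ l
      exact l.elim0
  · let ε : (Fin 1 → MvPolynomial σ K) →ₗ[MvPolynomial σ K] (MvPolynomial σ K ⧸ J) :=
      (Submodule.mkQ J).comp (LinearMap.proj 0)
    have hε : ∀ v, ε v = Ideal.Quotient.mk J (v 0) := fun v => rfl
    have hmem : ∀ v, v ∈ LinearMap.ker ε ↔ v 0 ∈ J := fun v => by
      rw [LinearMap.mem_ker, hε, Ideal.Quotient.eq_zero_iff_mem]
    have hc0 : ∀ v : Fin 1 → MvPolynomial σ K, ∀ e,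
        comp (fun _ => 0) e v 0 = homogeneousComponent e (v 0) := by
      intro v e
      simp [comp]
    refine exists_resolution _ ⟨1, fun _ => 0, LinearMap.ker ε, ?_⟩ ε ?_ ?_ rfl ?_
    · intro v hv e
      rw [hmem] at hv ⊢
      rw [hc0]
      exact hcomp _ hv e
    · intro e v hv
      refine Submodule.mem_map.2 ⟨v 0, ?_, rfl⟩
      rw [mem_homogeneousSubmodule]
      intro s hs
      have := hv 0 s hs
      rw [← this, Finsupp.degree_eq_weight_one]
      simp only [add_zero]
      rfl
    · intro y
      obtain ⟨x, rfl⟩ := Ideal.Quotient.mk_surjective y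
      exact ⟨fun _ => x, rfl⟩
    · intro v hv l
      rw [hmem] at hv
      obtain rfl : l = 0 := Subsingleton.elim _ _
      by_contra hc
      have := hcomp _ hv 0
      rw [homogeneousComponent_zero] at this
      exact hT (J.eq_top_of_isUnit_mem this (IsUnit.map C (Ne.isUnit hc)))

/-!
The proof compares resolutions directly, without homology functors.

Let `R = K[x_p : p ∉ H]` and let `π : S → R` be the retraction setting the variables in `H` to zero.
By maximality, a minor with a vertex in `H` has a whole edge in `H`, so both monomials of its
binomial are killed by `π` (`TwoMinor.mem_of_not_disjoint_of_maximal`), whereas the minors disjoint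
from `H` are untouched. Hence `I = π(I(𝒞))` extends to `I(𝒞')` in `S`
(`map_rename_map_killOutside_binomialIdeal`). Since `I(𝒞') ⊆ I(𝒞)`, the inclusion `R ⊆ S` and
`π` exhibit `R / I ^ t` as a graded algebra retract of `S / I(𝒞) ^ t`.

Betti numbers do not increase under such retracts (`betti_le_of_retract`). Both ring maps lift to
graded semilinear chain maps between the minimal resolutions (`exists_graded_lift`). Their composite
is a linear chain map lifting the identity of `R / I ^ t`, so it is homotopic to the identity and,
by minimality, equal to it modulo the maximal ideal (`constantCoeff_eq_zero_of_ε_eq_zero`). In each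
degree `j` this factors an identity matrix of size `β_{ij}(R / I ^ t)` over `K` through a space of
dimension `β_{ij}(S / I(𝒞) ^ t)`.

Finally `S` is free over `R`, so a minimal resolution of `R / I ^ t` over `R` base changes to one of
`S / I(𝒞') ^ t` over `S` with the same degrees (`exists_resolution_baseChange`), and the retract
inequality for the identity map bounds the Betti numbers of any other minimal resolution by these.
-/

/-! ### Semilinear maps out of free modules -/

section SemilinearMaps

variable {R R' : Type*} [CommRing R] [CommRing R'] {N : Type*} [AddCommGroup N] [Module R' N]
  {r : ℕ}

/-- The semilinear map over `a : R →+* R'` out of a free module sending the `k`-th standard basis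
vector to `y k`. -/
def semilinearLift (a : R →+* R') (y : Fin r → N) : (Fin r → R) →ₛₗ[a] N where
  toFun v := ∑ k, a (v k) • y k
  map_add' v w := by simp [add_smul, Finset.sum_add_distrib]
  map_smul' c v := by simp [mul_smul, Finset.smul_sum]

theorem semilinearLift_apply (a : R →+* R') (y : Fin r → N) (v : Fin r → R) :
    semilinearLift a y v = ∑ k, a (v k) • y k := rfl

@[simp]
theorem semilinearLift_single (a : R →+* R') (y : Fin r → N) (k : Fin r) :
    semilinearLift a y (Pi.single k 1) = y k := by
  rw [semilinearLift_apply, Finset.sum_eq_single k]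
  · simp
  · intro l _ hl
    simp [hl]
  · simp

theorem semilinear_apply_eq_sum {a : R →+* R'} (f : (Fin r → R) →ₛₗ[a] N) (v : Fin r → R) :
    f v = ∑ k, a (v k) • f (Pi.single k 1) := by
  conv_lhs => rw [pi_eq_sum_univ' v]
  simp only [map_sum, LinearMap.map_smulₛₗ]

/-- A linear map out of a free module factors through any linear map whose range contains its
range. -/
theorem exists_comp_eq_of_forall_mem_range {q : ℕ} (d : (Fin q → R') →ₗ[R'] N)
    (f : (Fin r → R') →ₗ[R'] N) (hf : ∀ v, ∃ w, d w = f v) :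
    ∃ h : (Fin r → R') →ₗ[R'] (Fin q → R'), ∀ v, d (h v) = f v := by
  choose w hw using hf
  refine ⟨semilinearLift (RingHom.id R') fun k => w (Pi.single k 1), fun v => ?_⟩
  rw [semilinear_apply_eq_sum f v]
  simp [semilinearLift_apply, map_sum, hw]

end SemilinearMaps

/-! ### Homogeneous vectors -/

section HomogeneousVectors

open MvPolynomial GradedFreeAux

variable {σ τ K : Type*} [Field K]

theorem isHomogeneousVector_iff {r : ℕ} {deg : Fin r → ℕ} {e : ℕ}
    {v : Fin r → MvPolynomial σ K} :
    IsHomogeneousVector deg e v ↔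
      ∀ l, v l = 0 ∨ ∃ k, k + deg l = e ∧ (v l).IsHomogeneous k := by
  refine forall_congr' fun l => ⟨fun h => ?_, fun h s hs => ?_⟩
  · by_cases h0 : v l = 0
    · exact Or.inl h0
    · obtain ⟨s, hs⟩ := ne_zero_iff.1 h0
      refine Or.inr ⟨s.degree, h s hs, fun s' hs' => ?_⟩
      have h1 := h s hs
      have h2 := h s' hs'
      have h3 : s'.degree = s.degree := by omega
      rwa [Finsupp.degree_eq_weight_one] at h3 ⊢
  · obtain h | ⟨k, hk, h⟩ := h
    · simp [h] at hs
    · have := h hs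
      rw [← hk, ← this, Finsupp.degree_eq_weight_one]
      rfl

theorem isHomogeneousVector_sum {ι : Type*} {r : ℕ} {deg : Fin r → ℕ} {e : ℕ} (s : Finset ι)
    {v : ι → Fin r → MvPolynomial σ K} (hv : ∀ i ∈ s, IsHomogeneousVector deg e (v i)) :
    IsHomogeneousVector deg e (∑ i ∈ s, v i) := by
  intro l t ht
  rw [Finset.sum_apply, coeff_sum] at ht
  obtain ⟨i, hi, h⟩ := Finset.exists_ne_zero_of_sum_ne_zero ht
  exact hv i hi l t h

theorem isHomogeneousVector_smul {r : ℕ} {deg : Fin r → ℕ} {d k : ℕ}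
    {v : Fin r → MvPolynomial σ K} (hv : IsHomogeneousVector deg d v) {p : MvPolynomial σ K}
    (hp : p.IsHomogeneous k) : IsHomogeneousVector deg (k + d) (p • v) := by
  rw [isHomogeneousVector_iff] at hv ⊢
  intro l
  obtain h | ⟨k', h', h⟩ := hv l
  · simp [h]
  · exact Or.inr ⟨k + k', by omega, hp.mul h⟩

theorem isHomogeneousVector_single {r : ℕ} (deg : Fin r → ℕ) (k : Fin r) :
    IsHomogeneousVector deg (deg k) (Pi.single k (1 : MvPolynomial σ K)) := by
  rw [isHomogeneousVector_iff]
  intro l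
  by_cases h : l = k
  · subst h
    exact Or.inr ⟨0, by simp, by simpa using isHomogeneous_one σ K⟩
  · exact Or.inl (by simp [h])

/-- An algebra map sending the variables to linear forms preserves degrees. -/
theorem isHomogeneous_map_of_forall_X {a : MvPolynomial σ K →ₐ[K] MvPolynomial τ K}
    (ha : ∀ s, (a (X s)).IsHomogeneous 1) {p : MvPolynomial σ K} {k : ℕ}
    (hp : p.IsHomogeneous k) : (a p).IsHomogeneous k := by
  rw [MvPolynomial.aeval_unique a]
  simpa [Function.comp_def] using hp.aeval (fun s => a (X s)) ha

theorem constantCoeff_map_of_forall_X {a : MvPolynomial σ K →ₐ[K] MvPolynomial τ K}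
    (ha : ∀ s, (a (X s)).IsHomogeneous 1) (p : MvPolynomial σ K) :
    constantCoeff (a p) = constantCoeff p := by
  induction p using MvPolynomial.induction_on with
  | C c => rw [← algebraMap_eq, AlgHom.commutes, algebraMap_eq, constantCoeff_C,
      algebraMap_eq, constantCoeff_C]
  | add p q hp hq => simp [hp, hq]
  | mul_X p s hp =>
    have h : constantCoeff (a (X s)) = 0 := by
      rw [constantCoeff_eq]
      exact (ha s).coeff_eq_zero (by simp)
    simp [h]

theorem isHomogeneousVector_map {a : MvPolynomial σ K →ₐ[K] MvPolynomial τ K}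
    (ha : ∀ s, (a (X s)).IsHomogeneous 1) {r q : ℕ} {deg : Fin r → ℕ} {deg' : Fin q → ℕ}
    (f : (Fin r → MvPolynomial σ K) →ₛₗ[a.toRingHom] (Fin q → MvPolynomial τ K))
    (hf : ∀ k, IsHomogeneousVector deg' (deg k) (f (Pi.single k 1))) {e : ℕ}
    {v : Fin r → MvPolynomial σ K} (hv : IsHomogeneousVector deg e v) :
    IsHomogeneousVector deg' e (f v) := by
  rw [semilinear_apply_eq_sum f v]
  refine isHomogeneousVector_sum _ fun k _ => ?_
  obtain h | ⟨d, hd, h⟩ := isHomogeneousVector_iff.1 hv k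
  · intro l s hs
    simp [h] at hs
  · rw [← hd]
    exact isHomogeneousVector_smul (hf k) (isHomogeneous_map_of_forall_X ha h)

end HomogeneousVectors

/-! ### Lifting maps to resolutions -/

section Lifting

open MvPolynomial GradedFreeAux

variable {σ τ K : Type*} [Field K]

theorem mem_quotientGrading_iff {J : Ideal (MvPolynomial σ K)} {e : ℕ}
    {y : MvPolynomial σ K ⧸ J} :
    y ∈ quotientGrading J e ↔ ∃ p, p.IsHomogeneous e ∧ Ideal.Quotient.mk J p = y :=
  Iff.rfl

theorem quotientMap_smul {R R' : Type*} [CommRing R] [CommRing R'] {I : Ideal R} {J : Ideal R'}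
    (f : R →+* R') (h : I ≤ J.comap f) (p : R) (y : R ⧸ I) :
    Ideal.quotientMap J f h (p • y) = f p • Ideal.quotientMap J f h y := by
  obtain ⟨q, rfl⟩ := Ideal.Quotient.mk_surjective y
  exact Ideal.quotientMap_mk.trans
    ((congrArg (Ideal.Quotient.mk J) (map_mul f p q)).trans (map_mul _ _ _))

namespace MinimalGradedFreeResolution

/-- A homogeneous element of `S / J` has a homogeneous preimage: since `J` is homogeneous, the degree
`e` component of an arbitrary preimage works. -/
theorem exists_isHomogeneousVector_ε_eq {J : Ideal (MvPolynomial σ K)}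
    (hJ : ∀ x ∈ J, ∀ e, homogeneousComponent e x ∈ J)
    (G : MinimalGradedFreeResolution (σ := σ) (quotientGrading J)) {e : ℕ}
    {y : MvPolynomial σ K ⧸ J} (hy : y ∈ quotientGrading J e) :
    ∃ w, IsHomogeneousVector (G.deg 0) e w ∧ G.ε w = y := by
  obtain ⟨v, rfl⟩ := G.ε_surjective y
  refine ⟨comp (G.deg 0) e v, comp_isHomogeneousVector _ _ _, ?_⟩
  obtain ⟨p, hp, hpv⟩ := mem_quotientGrading_iff.1 hy
  obtain ⟨T, hT⟩ := sum_comp (G.deg 0) v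
  choose q hq hqv using fun e' => mem_quotientGrading_iff.1
    (G.ε_graded e' _ (comp_isHomogeneousVector (G.deg 0) e' v))
  have hmem : p - ∑ e' ∈ T, q e' ∈ J := by
    rw [← Ideal.Quotient.eq_zero_iff_mem, map_sub, hpv, map_sum]
    conv_lhs => rw [hT]
    simp [hqv]
  have hcomp := hJ _ hmem e
  have hpe : homogeneousComponent e p = p := by
    rw [homogeneousComponent_of_mem hp, if_pos rfl]
  have hqe : ∀ e', homogeneousComponent e (q e') = if e = e' then q e' else 0 :=
    fun e' => homogeneousComponent_of_mem (hq e')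
  rw [map_sub, hpe, map_sum] at hcomp
  simp only [hqe, Finset.sum_ite_eq] at hcomp
  rw [← hpv]
  split_ifs at hcomp with heT
  · rw [← hqv, eq_comm, Ideal.Quotient.eq]
    exact hcomp
  · have h0 : comp (G.deg 0) e v = 0 := by
      conv_lhs => rw [hT]
      rw [map_sum]
      refine Finset.sum_eq_zero fun e' he' => ?_
      rw [comp_of_homogeneous (comp_isHomogeneousVector _ _ _), if_neg]
      rintro rfl
      exact heT he'
    rw [h0, map_zero, eq_comm, Ideal.Quotient.eq_zero_iff_mem]
    simpa using hcomp

theorem exists_isHomogeneousVector_d_eq {J : Ideal (MvPolynomial σ K)}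
    (G : MinimalGradedFreeResolution (σ := σ) (quotientGrading J)) {i e : ℕ}
    {y : Fin (G.rank i) → MvPolynomial σ K} (hy : IsHomogeneousVector (G.deg i) e y)
    (hr : ∃ w, G.d i w = y) :
    ∃ w, IsHomogeneousVector (G.deg (i + 1)) e w ∧ G.d i w = y := by
  obtain ⟨w, rfl⟩ := hr
  refine ⟨comp (G.deg (i + 1)) e w, comp_isHomogeneousVector _ _ _, ?_⟩
  rw [← comp_map (G.d i) (G.d_graded i), comp_of_homogeneous hy, if_pos rfl]

variable {I : Ideal (MvPolynomial σ K)} {J : Ideal (MvPolynomial τ K)}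

/-- A graded semilinear map between the `i`-th terms of two resolutions carrying boundaries to
boundaries. -/
structure LiftStage (a : MvPolynomial σ K →ₐ[K] MvPolynomial τ K)
    (F : MinimalGradedFreeResolution (σ := σ) (quotientGrading I))
    (G : MinimalGradedFreeResolution (σ := τ) (quotientGrading J)) (i : ℕ) where
  map : (Fin (F.rank i) → MvPolynomial σ K) →ₛₗ[a.toRingHom] (Fin (G.rank i) → MvPolynomial τ K)
  graded : ∀ k, IsHomogeneousVector (G.deg i) (F.deg i k) (map (Pi.single k 1))
  boundary : ∀ v, ∃ w, G.d i w = map (F.d i v)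

theorem exists_liftStage_zero (a : MvPolynomial σ K →ₐ[K] MvPolynomial τ K)
    (ha : ∀ s, (a (X s)).IsHomogeneous 1) (hJ : ∀ x ∈ J, ∀ e, homogeneousComponent e x ∈ J)
    (F : MinimalGradedFreeResolution (σ := σ) (quotientGrading I))
    (G : MinimalGradedFreeResolution (σ := τ) (quotientGrading J))
    (h : I ≤ J.comap a.toRingHom) :
    ∃ s : LiftStage a F G 0,
      ∀ v, G.ε (s.map v) = Ideal.quotientMap J a.toRingHom h (F.ε v) := by
  have key : ∀ k, ∃ w, IsHomogeneousVector (G.deg 0) (F.deg 0 k) w ∧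
      G.ε w = Ideal.quotientMap J a.toRingHom h (F.ε (Pi.single k 1)) := by
    intro k
    refine exists_isHomogeneousVector_ε_eq hJ G ?_
    obtain ⟨p, hp, hpk⟩ := mem_quotientGrading_iff.1
      (F.ε_graded _ _ (isHomogeneousVector_single (F.deg 0) k))
    rw [← hpk, Ideal.quotientMap_mk]
    exact mem_quotientGrading_iff.2 ⟨_, isHomogeneous_map_of_forall_X ha hp, rfl⟩
  choose y hy hyε using key
  have hε : ∀ v, G.ε (semilinearLift a.toRingHom y v) =
      Ideal.quotientMap J a.toRingHom h (F.ε v) := by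
    intro v
    rw [semilinear_apply_eq_sum F.ε v, semilinearLift_apply]
    simp only [map_sum, LinearMap.map_smul, hyε, quotientMap_smul, RingHom.id_apply]
  refine ⟨⟨semilinearLift a.toRingHom y, fun k => by rw [semilinearLift_single]; exact hy k,
    fun v => ?_⟩, hε⟩
  refine (G.exact_zero _).1 ?_
  rw [hε, (F.exact_zero _).2 ⟨v, rfl⟩, map_zero]

theorem exists_liftStage_succ (a : MvPolynomial σ K →ₐ[K] MvPolynomial τ K)
    (ha : ∀ s, (a (X s)).IsHomogeneous 1)
    (F : MinimalGradedFreeResolution (σ := σ) (quotientGrading I))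
    (G : MinimalGradedFreeResolution (σ := τ) (quotientGrading J)) (i : ℕ)
    (s : LiftStage a F G i) :
    ∃ s' : LiftStage a F G (i + 1), ∀ v, G.d i (s'.map v) = s.map (F.d i v) := by
  have key : ∀ k, ∃ w, IsHomogeneousVector (G.deg (i + 1)) (F.deg (i + 1) k) w ∧
      G.d i w = s.map (F.d i (Pi.single k 1)) := fun k =>
    exists_isHomogeneousVector_d_eq G
      (isHomogeneousVector_map ha s.map s.graded
        (F.d_graded _ _ _ (isHomogeneousVector_single _ k))) (s.boundary _)
  choose y hy hyd using key
  have hd : ∀ v, G.d i (semilinearLift a.toRingHom y v) = s.map (F.d i v) := by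
    intro v
    rw [semilinear_apply_eq_sum (F.d i) v, semilinearLift_apply]
    simp only [map_sum, map_smul, hyd, RingHom.id_apply, LinearMap.map_smulₛₗ]
  refine ⟨⟨semilinearLift a.toRingHom y, fun k => by rw [semilinearLift_single]; exact hy k,
    fun v => ?_⟩, hd⟩
  refine (G.exact_succ i _).1 ?_
  rw [hd, (F.exact_succ i _).2 ⟨v, rfl⟩, map_zero]

/-- A degree-preserving algebra map `a` with `a(I) ⊆ J` lifts to a graded `a`-semilinear chain map
from a resolution of `S / I` to one of `T / J`. -/
theorem exists_graded_lift (a : MvPolynomial σ K →ₐ[K] MvPolynomial τ K)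
    (ha : ∀ s, (a (X s)).IsHomogeneous 1) (hJ : ∀ x ∈ J, ∀ e, homogeneousComponent e x ∈ J)
    (F : MinimalGradedFreeResolution (σ := σ) (quotientGrading I))
    (G : MinimalGradedFreeResolution (σ := τ) (quotientGrading J))
    (h : I ≤ J.comap a.toRingHom) :
    ∃ φ : ∀ i, (Fin (F.rank i) → MvPolynomial σ K) →ₛₗ[a.toRingHom]
        (Fin (G.rank i) → MvPolynomial τ K),
      (∀ v, G.ε (φ 0 v) = Ideal.quotientMap J a.toRingHom h (F.ε v)) ∧
      (∀ i v, G.d i (φ (i + 1) v) = φ i (F.d i v)) ∧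
      ∀ i k, IsHomogeneousVector (G.deg i) (F.deg i k) (φ i (Pi.single k 1)) := by
  obtain ⟨s0, hs0⟩ := exists_liftStage_zero a ha hJ F G h
  choose nxt hnxt using exists_liftStage_succ a ha F G
  let st : ∀ i, LiftStage a F G i := fun i => Nat.rec s0 nxt i
  exact ⟨fun i => (st i).map, hs0, fun i => hnxt i (st i), fun i => (st i).graded⟩

end MinimalGradedFreeResolution

end Lifting

/-! ### Betti numbers of retracts -/

section Retracts

open MvPolynomial GradedFreeAux

variable {σ τ K : Type*} [Field K]

namespace MinimalGradedFreeResolution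

variable {I : Ideal (MvPolynomial σ K)} {J : Ideal (MvPolynomial τ K)}

/-- A chain map of a minimal resolution to itself that induces zero on the resolved module is
null-homotopic, hence zero modulo the maximal ideal. -/
theorem constantCoeff_eq_zero_of_ε_eq_zero
    (F : MinimalGradedFreeResolution (σ := σ) (quotientGrading I))
    (κ : ∀ i, (Fin (F.rank i) → MvPolynomial σ K) →ₗ[MvPolynomial σ K]
      (Fin (F.rank i) → MvPolynomial σ K))
    (hε : ∀ v, F.ε (κ 0 v) = 0) (hd : ∀ i v, F.d i (κ (i + 1) v) = κ i (F.d i v)) (i : ℕ)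
    (v : Fin (F.rank i) → MvPolynomial σ K) (l : Fin (F.rank i)) :
    constantCoeff (κ i v l) = 0 := by
  have dd : ∀ i v, F.d i (F.d (i + 1) v) = 0 := fun i v => (F.exact_succ i _).2 ⟨v, rfl⟩
  -- The homotopy is built one step at a time; `h` is its `i`-th component.
  have key : ∀ i, (∃ h : (Fin (F.rank i) → MvPolynomial σ K) →ₗ[MvPolynomial σ K]
      (Fin (F.rank (i + 1)) → MvPolynomial σ K),
        ∀ v, κ i (F.d i v) = F.d i (h (F.d i v))) ∧
      ∀ v l, constantCoeff (κ i v l) = 0 := by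
    intro i
    induction i with
    | zero =>
      obtain ⟨h, hh⟩ := exists_comp_eq_of_forall_mem_range (F.d 0) (κ 0)
        fun v => (F.exact_zero _).1 (hε v)
      refine ⟨⟨h, fun v => (hh _).symm⟩, fun v l => ?_⟩
      rw [← hh]
      exact F.minimal _ _ _
    | succ i ih =>
      obtain ⟨⟨h, hh⟩, -⟩ := ih
      obtain ⟨h', hh'⟩ := exists_comp_eq_of_forall_mem_range (F.d (i + 1))
        (κ (i + 1) - h.comp (F.d i)) fun v => (F.exact_succ i _).1 (by
          rw [LinearMap.sub_apply, LinearMap.comp_apply, map_sub, hd, hh, sub_self])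
      refine ⟨⟨h', fun v => ?_⟩, fun v l => ?_⟩
      · rw [hh', LinearMap.sub_apply, LinearMap.comp_apply, dd, map_zero, sub_zero]
      · have h1 : κ (i + 1) v = F.d (i + 1) (h' v) + h (F.d i v) := by
          rw [hh', LinearMap.sub_apply, LinearMap.comp_apply, sub_add_cancel]
        rw [h1, Pi.add_apply, map_add, F.minimal, zero_add, semilinear_apply_eq_sum h]
        simp [F.minimal]
  exact (key i).2 v l

theorem constantCoeff_eq_zero_of_ne {r : ℕ} {deg : Fin r → ℕ} {e : ℕ}
    {v : Fin r → MvPolynomial σ K} (hv : IsHomogeneousVector deg e v) {l : Fin r}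
    (h : deg l ≠ e) : constantCoeff (v l) = 0 := by
  by_contra h0
  rw [constantCoeff_eq] at h0
  have := hv l 0 h0
  simp at this
  exact h this

/-- Graded Betti numbers do not increase under degree-preserving algebra retracts. -/
theorem betti_le_of_retract (a : MvPolynomial σ K →ₐ[K] MvPolynomial τ K)
    (b : MvPolynomial τ K →ₐ[K] MvPolynomial σ K)
    (ha : ∀ s, (a (X s)).IsHomogeneous 1) (hb : ∀ s, (b (X s)).IsHomogeneous 1)
    (hba : ∀ p, b (a p) = p)
    (hI : ∀ x ∈ I, ∀ e, homogeneousComponent e x ∈ I)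
    (hJ : ∀ x ∈ J, ∀ e, homogeneousComponent e x ∈ J)
    (hIJ : I ≤ J.comap a.toRingHom) (hJI : J ≤ I.comap b.toRingHom)
    (F : MinimalGradedFreeResolution (σ := σ) (quotientGrading I))
    (G : MinimalGradedFreeResolution (σ := τ) (quotientGrading J)) (i j : ℕ) :
    F.betti i j ≤ G.betti i j := by
  classical
  obtain ⟨φ, φε, φd, φg⟩ := exists_graded_lift a ha hJ F G hIJ
  obtain ⟨ψ, ψε, ψd, ψg⟩ := exists_graded_lift b hb hI G F hJI
  let κ : ∀ i, (Fin (F.rank i) → MvPolynomial σ K) →ₗ[MvPolynomial σ K]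
      (Fin (F.rank i) → MvPolynomial σ K) := fun i =>
    { toFun := fun v => ψ i (φ i v) - v
      map_add' := fun v w => by simp only [map_add]; abel
      map_smul' := fun c v => by
        have hc : b.toRingHom (a.toRingHom c) = c := hba c
        simp only [LinearMap.map_smulₛₗ, hc, smul_sub, RingHom.id_apply] }
  have hκ : ∀ i v, κ i v = ψ i (φ i v) - v := fun _ _ => rfl
  have hzero := constantCoeff_eq_zero_of_ε_eq_zero F κ (fun v => by
      rw [hκ, map_sub, ψε, φε]
      obtain ⟨p, hp⟩ := Ideal.Quotient.mk_surjective (F.ε v)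
      rw [← hp, Ideal.quotientMap_mk, Ideal.quotientMap_mk, sub_eq_zero]
      exact congrArg _ (hba p))
    (fun i v => by rw [hκ, hκ, map_sub, ψd, φd]) i
  -- The matrices of the two chain maps modulo the maximal ideals.
  let A : Fin (F.rank i) → Fin (G.rank i) → K := fun k l =>
    constantCoeff (φ i (Pi.single k 1) l)
  let B : Fin (G.rank i) → Fin (F.rank i) → K := fun l k =>
    constantCoeff (ψ i (Pi.single l 1) k)
  have hBA : ∀ k k', ∑ l, A k l * B l k' = if k = k' then 1 else 0 := by
    intro k k'
    have h := hzero (Pi.single k 1) k'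
    rw [hκ, Pi.sub_apply, map_sub, sub_eq_zero, semilinear_apply_eq_sum (ψ i)] at h
    have hcb : ∀ p, constantCoeff (b.toRingHom p) = constantCoeff p :=
      constantCoeff_map_of_forall_X hb
    simp only [Finset.sum_apply, Pi.smul_apply, smul_eq_mul, map_sum, map_mul, hcb] at h
    refine h.trans ?_
    rw [Pi.single_apply]
    simp [apply_ite, eq_comm]
  -- A graded map modulo the maximal ideal only relates basis vectors of equal degree.
  have hA : ∀ k l, F.deg i k ≠ G.deg i l → A k l = 0 := fun k l h =>
    constantCoeff_eq_zero_of_ne (φg i k) h.symm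
  -- The degree `j` blocks of the two matrices compose to the identity.
  let A' : Matrix {k // F.deg i k = j} {l // G.deg i l = j} K := fun k l => A k l
  let B' : Matrix {l // G.deg i l = j} {k // F.deg i k = j} K := fun l k => B l k
  have hAB' : A' * B' = 1 := by
    ext k k'
    rw [Matrix.mul_apply, Matrix.one_apply]
    have h1 := hBA k k'
    simp only [Subtype.coe_inj] at h1
    rw [← h1]
    refine Finset.sum_bij_ne_zero (fun l _ _ => l.1) (fun _ _ _ => Finset.mem_univ _)
      (fun _ _ _ _ _ _ h => Subtype.ext h) (fun l _ hl => ?_) (fun _ _ _ => rfl)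
    have hl' : G.deg i l = j := by
      by_contra hne
      exact hl (by rw [hA _ _ (by rw [k.2]; exact Ne.symm hne), zero_mul])
    exact ⟨⟨l, hl'⟩, Finset.mem_univ _, hl, rfl⟩
  have hcard : Fintype.card {k // F.deg i k = j} ≤ Fintype.card {l // G.deg i l = j} := by
    rw [← Matrix.rank_one (R := K) (n := {k // F.deg i k = j}), ← hAB']
    exact (Matrix.rank_mul_le_left A' B').trans (Matrix.rank_le_card_width A')
  rwa [Fintype.card_subtype, Fintype.card_subtype] at hcard

end MinimalGradedFreeResolution

end Retracts

/-! ### Flat base change of resolutions -/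

section BaseChange

variable {R T ι : Type*} [CommRing R] [CommRing T] [Algebra R T] {r q : ℕ}

/-- The base change to an `R`-algebra `T` of a linear map between finite free `R`-modules, in terms
of the standard bases. -/
noncomputable def freeBaseChange (T : Type*) [CommRing T] [Algebra R T]
    (f : (Fin r → R) →ₗ[R] (Fin q → R)) : (Fin r → T) →ₗ[T] (Fin q → T) :=
  semilinearLift (RingHom.id T) fun k => algebraMap R T ∘ f (Pi.single k 1)

theorem freeBaseChange_single (f : (Fin r → R) →ₗ[R] (Fin q → R)) (k : Fin r) :
    freeBaseChange T f (Pi.single k 1) = algebraMap R T ∘ f (Pi.single k 1) :=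
  semilinearLift_single _ _ _

theorem freeBaseChange_algebraMap (f : (Fin r → R) →ₗ[R] (Fin q → R)) (v : Fin r → R) :
    freeBaseChange T f (algebraMap R T ∘ v) = algebraMap R T ∘ f v := by
  rw [semilinear_apply_eq_sum f v, freeBaseChange, semilinearLift_apply]
  ext l
  simp [Algebra.smul_def]

theorem repr_freeBaseChange (b : Module.Basis ι R T) (f : (Fin r → R) →ₗ[R] (Fin q → R))
    (w : Fin r → T) (l : Fin q) (α : ι) :
    b.repr (freeBaseChange T f w l) α = f (fun k => b.repr (w k) α) l := by
  rw [semilinear_apply_eq_sum f, freeBaseChange, semilinearLift_apply]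
  simp only [Finset.sum_apply, Pi.smul_apply, RingHom.id_apply, smul_eq_mul, map_sum,
    Finsupp.finsetSum_apply, Function.comp_apply]
  refine Finset.sum_congr rfl fun k _ => ?_
  rw [mul_comm, ← Algebra.smul_def, map_smul, Finsupp.smul_apply, smul_eq_mul, mul_comm]

theorem exists_eq_sum_basis_smul (b : Module.Basis ι R T) (w : Fin r → T) :
    ∃ s : Finset ι, w = ∑ α ∈ s, b α • (algebraMap R T ∘ fun k => b.repr (w k) α) := by
  classical
  refine ⟨Finset.univ.biUnion fun k => (b.repr (w k)).support, ?_⟩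
  ext k
  rw [Finset.sum_apply]
  conv_lhs => rw [← b.linearCombination_repr (w k), Finsupp.linearCombination_apply,
    Finsupp.sum_of_support_subset (s := Finset.univ.biUnion fun k => (b.repr (w k)).support) _
      (Finset.subset_biUnion_of_mem (fun k => (b.repr (w k)).support) (Finset.mem_univ k)) _
      (by simp)]
  refine Finset.sum_congr rfl fun α _ => ?_
  simp [Algebra.smul_def, mul_comm]

/-- If the coordinates of `w` all lie in the range of `f`, then `w` lies in the range of the base
change of `f`. -/
theorem exists_freeBaseChange_eq (b : Module.Basis ι R T) (f : (Fin r → R) →ₗ[R] (Fin q → R))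
    (w : Fin q → T) (h : ∀ α, ∃ v, f v = fun l => b.repr (w l) α) :
    ∃ v, freeBaseChange T f v = w := by
  choose u hu using h
  obtain ⟨s, hs⟩ := exists_eq_sum_basis_smul b w
  refine ⟨∑ α ∈ s, b α • (algebraMap R T ∘ u α), ?_⟩
  rw [map_sum]
  conv_rhs => rw [hs]
  refine Finset.sum_congr rfl fun α _ => ?_
  rw [map_smul, freeBaseChange_algebraMap, hu]

theorem exact_freeBaseChange (b : Module.Basis ι R T) {p : ℕ}
    {f : (Fin r → R) →ₗ[R] (Fin q → R)} {g : (Fin q → R) →ₗ[R] (Fin p → R)}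
    (h : Function.Exact f g) : Function.Exact (freeBaseChange T f) (freeBaseChange T g) := by
  intro w
  constructor
  · intro hw
    refine exists_freeBaseChange_eq b f w fun α => (h _).1 ?_
    ext l
    rw [← repr_freeBaseChange, hw]
    simp
  · rintro ⟨v, rfl⟩
    ext l
    refine b.repr.injective (Finsupp.ext fun α => ?_)
    have h0 : g (f fun k => b.repr (v k) α) = 0 := (h _).2 ⟨_, rfl⟩
    simp only [repr_freeBaseChange, h0]
    simp

theorem repr_mem_of_mem_map (b : Module.Basis ι R T) {I : Ideal R} {x : T}
    (hx : x ∈ I.map (algebraMap R T)) (α : ι) : b.repr x α ∈ I := by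
  have hx' : x ∈ (I • ⊤ : Submodule R T) := by
    rw [Ideal.smul_top_eq_map]
    exact hx
  induction hx' using Submodule.smul_induction_on' with
  | smul c hc t _ =>
    rw [map_smul, Finsupp.smul_apply, smul_eq_mul]
    exact I.mul_mem_right _ hc
  | add y _ z _ hy hz =>
    rw [map_add, Finsupp.add_apply]
    exact I.add_mem (hy (by rwa [Ideal.smul_top_eq_map] at *))
      (hz (by rwa [Ideal.smul_top_eq_map] at *))

end BaseChange

section ResolutionBaseChange

open MvPolynomial GradedFreeAux

variable {σ τ K ι : Type*} [Field K]

theorem smul_mem_quotientGrading {J : Ideal (MvPolynomial σ K)} {d k : ℕ}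
    {y : MvPolynomial σ K ⧸ J} (hy : y ∈ quotientGrading J d) {p : MvPolynomial σ K}
    (hp : p.IsHomogeneous k) : p • y ∈ quotientGrading J (k + d) := by
  obtain ⟨x, hx, rfl⟩ := mem_quotientGrading_iff.1 hy
  exact mem_quotientGrading_iff.2 ⟨p * x, hp.mul hx, rfl⟩

/-- A minimal graded free resolution of `S / I` yields one of `T / IT`, with the same ranks and
degrees, for every extension `S ⊆ T` of polynomial rings making `T` a free `S`-module. -/
theorem exists_resolution_baseChange [Algebra (MvPolynomial σ K) (MvPolynomial τ K)]
    (b : Module.Basis ι (MvPolynomial σ K) (MvPolynomial τ K))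
    (a : MvPolynomial σ K →ₐ[K] MvPolynomial τ K)
    (hab : ∀ p, algebraMap (MvPolynomial σ K) (MvPolynomial τ K) p = a p)
    (ha : ∀ s, (a (X s)).IsHomogeneous 1) {I : Ideal (MvPolynomial σ K)}
    (F : MinimalGradedFreeResolution (σ := σ) (quotientGrading I)) :
    ∃ G : MinimalGradedFreeResolution (σ := τ)
        (quotientGrading (I.map (algebraMap (MvPolynomial σ K) (MvPolynomial τ K)))),
      ∀ i j, G.betti i j = F.betti i j := by
  let f := algebraMap (MvPolynomial σ K) (MvPolynomial τ K)
  let Q := Ideal.quotientMap (I.map f) f Ideal.le_comap_map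
  have hX : ∀ s, (AlgHom.id K (MvPolynomial τ K) (X s)).IsHomogeneous 1 :=
    fun s => isHomogeneous_X K s
  let ε : (Fin (F.rank 0) → MvPolynomial τ K) →ₗ[MvPolynomial τ K] MvPolynomial τ K ⧸ I.map f :=
    semilinearLift (RingHom.id _) fun k => Q (F.ε (Pi.single k 1))
  have hε : ∀ v, ε (f ∘ v) = Q (F.ε v) := by
    intro v
    rw [semilinear_apply_eq_sum F.ε v]
    simp only [ε, semilinearLift_apply, map_sum, Q, quotientMap_smul]
    rfl
  have hgr : ∀ i k, IsHomogeneousVector (F.deg i) (F.deg (i + 1) k)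
      (f ∘ F.d i (Pi.single k 1)) := by
    intro i k
    have := F.d_graded i _ _ (isHomogeneousVector_single (F.deg (i + 1)) k)
    rw [isHomogeneousVector_iff] at this ⊢
    intro l
    obtain h | ⟨d, hd, h⟩ := this l
    · exact Or.inl (by simp [h])
    · refine Or.inr ⟨d, hd, ?_⟩
      rw [Function.comp_apply, hab]
      exact isHomogeneous_map_of_forall_X ha h
  refine ⟨{
    rank := F.rank
    deg := F.deg
    d := fun i => freeBaseChange _ (F.d i)
    ε := ε
    d_graded := ?_
    ε_graded := ?_
    ε_surjective := ?_
    exact_zero := ?_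
    exact_succ := fun i => exact_freeBaseChange b (F.exact_succ i)
    minimal := ?_ }, fun i j => rfl⟩
  · intro i e v hv
    refine isHomogeneousVector_map hX (freeBaseChange _ (F.d i)) (fun k => ?_) hv
    exact (freeBaseChange_single (T := MvPolynomial τ K) (F.d i) k).symm ▸ hgr i k
  · intro e v hv
    rw [semilinear_apply_eq_sum ε v]
    refine Submodule.sum_mem _ fun k _ => ?_
    obtain h | ⟨d, hd, h⟩ := isHomogeneousVector_iff.1 hv k
    · simp [h]
    · rw [← hd]
      refine smul_mem_quotientGrading ?_ h
      obtain ⟨p, hp, hpk⟩ := mem_quotientGrading_iff.1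
        (F.ε_graded _ _ (isHomogeneousVector_single (F.deg 0) k))
      refine mem_quotientGrading_iff.2 ⟨f p, ?_, ?_⟩
      · rw [hab]
        exact isHomogeneous_map_of_forall_X ha hp
      · simp only [ε, semilinearLift_single, ← hpk]
        rfl
  · intro y
    obtain ⟨p, rfl⟩ := Ideal.Quotient.mk_surjective y
    obtain ⟨v, hv⟩ := F.ε_surjective 1
    refine ⟨p • (f ∘ v), ?_⟩
    rw [map_smul, hε, hv, map_one]
    exact congrArg (Ideal.Quotient.mk _) (mul_one p)
  · intro w
    constructor
    · intro hw
      refine exists_freeBaseChange_eq b (F.d 0) w fun α => (F.exact_zero _).1 ?_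
      choose g hg using fun k => Ideal.Quotient.mk_surjective (F.ε (Pi.single k 1))
      have hmem : ∑ k, f (g k) * w k ∈ I.map f := by
        rw [← Ideal.Quotient.eq_zero_iff_mem, ← hw, semilinearLift_apply, map_sum]
        refine Finset.sum_congr rfl fun k _ => ?_
        rw [← hg, mul_comm]
        rfl
      have hrepr := repr_mem_of_mem_map b hmem α
      simp only [f, ← Algebra.smul_def, map_sum, map_smul, Finsupp.finsetSum_apply,
        Finsupp.smul_apply, smul_eq_mul] at hrepr
      rw [semilinear_apply_eq_sum F.ε, ← Ideal.Quotient.eq_zero_iff_mem.2 hrepr, map_sum]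
      refine Finset.sum_congr rfl fun k _ => ?_
      rw [← hg, mul_comm]
      rfl
    · rintro ⟨v, rfl⟩
      rw [semilinear_apply_eq_sum (freeBaseChange (MvPolynomial τ K) (F.d 0)) v, map_sum]
      refine Finset.sum_eq_zero fun k _ => ?_
      rw [map_smul, freeBaseChange_single]
      change _ • ε (f ∘ _) = 0
      rw [hε, (F.exact_zero _).2 ⟨_, rfl⟩, map_zero, smul_zero]
  · intro i v l
    rw [semilinear_apply_eq_sum (freeBaseChange _ (F.d i)) v]
    simp only [Finset.sum_apply, Pi.smul_apply, smul_eq_mul, map_sum, map_mul,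
      freeBaseChange_single, Function.comp_apply, hab]
    refine Finset.sum_eq_zero fun k _ => ?_
    rw [constantCoeff_map_of_forall_X ha, F.minimal, mul_zero]

/-- A polynomial ring is free over the polynomial subring on a subset of the variables. -/
theorem exists_basis_over_rename_val (U : Set τ) :
    letI : Algebra (MvPolynomial U K) (MvPolynomial τ K) :=
      (rename (R := K) ((↑) : U → τ)).toRingHom.toAlgebra
    Nonempty (Module.Basis ((Uᶜ : Set τ) →₀ ℕ) (MvPolynomial U K) (MvPolynomial τ K)) := by
  classical
  let : Algebra (MvPolynomial U K) (MvPolynomial τ K) :=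
    (rename (R := K) ((↑) : U → τ)).toRingHom.toAlgebra
  let e : MvPolynomial τ K ≃ₐ[K] MvPolynomial (Uᶜ : Set τ) (MvPolynomial U K) :=
    (renameEquiv K ((Equiv.sumComm _ _).trans (Equiv.Set.sumCompl U)).symm).trans
      (sumAlgEquiv K _ _)
  have he : ∀ p : MvPolynomial U K, e (rename (↑) p) = C p := by
    intro p
    have hcomp : (e : MvPolynomial τ K →ₐ[K] _).comp (rename ((↑) : U → τ)) =
        (IsScalarTower.toAlgHom K (MvPolynomial U K)
          (MvPolynomial (Uᶜ : Set τ) (MvPolynomial U K))) := by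
      refine algHom_ext fun s => ?_
      have hs : e (rename (↑) (X s : MvPolynomial U K)) =
          sumAlgEquiv K (Uᶜ : Set τ) U (X (Sum.inr s)) := by simp [e]
      simpa using hs.trans (sumRingEquiv_X_inr K _ _ s)
    exact DFunLike.congr_fun hcomp p
  -- The same isomorphism, linear over the subring because it sends its elements to constants.
  let e' : MvPolynomial τ K ≃ₗ[MvPolynomial U K] MvPolynomial (Uᶜ : Set τ) (MvPolynomial U K) :=
    { e with
      map_smul' := fun c p => by
        have h1 : c • p = rename (↑) c * p := rfl
        have h2 : e (rename (↑) c * p) = C c * e p := by rw [map_mul, he]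
        rw [h1]
        exact h2.trans (C_mul' (a := c) (p := e p)) }
  exact ⟨(basisMonomials (Uᶜ : Set τ) (MvPolynomial U K)).map e'.symm⟩

end ResolutionBaseChange

/-! ### Setting the variables of a maximal interval to zero -/

section Intervals

open MvPolynomial

variable {m n : ℕ}

/-- A maximal connected set of vertices on a line (a fibre of `f`) contains every neighbour, on the
same line, of its elements. -/
theorem mem_of_adj_of_maximal {α β : Type*} {G : SimpleGraph α} {V : Set α} {f : α → β}
    {H : Set α}
    (hH : Maximal (fun U : Set α => U.Nonempty ∧ U ⊆ V ∧ (∃ i, ∀ p ∈ U, f p = i) ∧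
      ∀ p ∈ U, ∀ q ∈ U, G.Reachable p q) H)
    {p q : α} (hp : p ∈ H) (hpq : G.Adj p q) (hq : q ∈ V) (hf : f q = f p) : q ∈ H := by
  obtain ⟨⟨-, hsub, ⟨i, hi⟩, hreach⟩, hmax⟩ := hH
  have hto : ∀ x ∈ insert q H, G.Reachable x p := by
    rintro x (rfl | hx)
    · exact hpq.reachable.symm
    · exact hreach _ hx _ hp
  refine hmax (y := insert q H) ⟨Set.insert_nonempty _ _, Set.insert_subset hq hsub, ⟨i, ?_⟩,
    fun x hx y hy => (hto x hx).trans (hto y hy).symm⟩ (Set.subset_insert _ _)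
    (Set.mem_insert _ _)
  rintro x (rfl | hx)
  · exact hf.trans (hi p hp)
  · exact hi x hx

namespace TwoMinor

/-- A minor having a vertex in a maximal interval `H` has an edge inside `H`, so that both monomials
of its binomial involve a variable from `H`. -/
theorem mem_of_not_disjoint_of_maximal {C : Set (TwoMinor m n)} {H : Set (Fin m × Fin n)}
    (hH : IsMaximalVerticalInterval C H ∨ IsMaximalHorizontalInterval C H) {δ : TwoMinor m n}
    (hδ : δ ∈ C) (h : ¬ Disjoint δ.vertices H) :
    ((δ.a₁, δ.b₁) ∈ H ∨ (δ.a₂, δ.b₂) ∈ H) ∧ ((δ.a₁, δ.b₂) ∈ H ∨ (δ.a₂, δ.b₁) ∈ H) := by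
  have hV : δ.vertices ⊆ vertexSet C := Set.subset_biUnion_of_mem (u := vertices) hδ
  obtain ⟨p, hpδ, hpH⟩ := Set.not_disjoint_iff.1 h
  have hra := δ.row_lt.ne
  have hcb := δ.col_lt.ne
  rcases hH with hH | hH
  · have key : ∀ q q' : Fin m × Fin n, s(q, q') ∈ δ.verticalEdges → q ≠ q' → q' ∈ δ.vertices →
        q'.2 = q.2 → q ∈ H → q' ∈ H := fun q q' he hne hq' hf hq =>
      mem_of_adj_of_maximal (f := Prod.snd) (G := verticalGraph C) hH hq
        ((SimpleGraph.fromEdgeSet_adj _).2 ⟨Set.mem_biUnion hδ he, hne⟩) (hV hq') hf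
    rcases hpδ with rfl | rfl | rfl | rfl
    · exact ⟨Or.inl hpH, Or.inr (key _ _ (Or.inl rfl) (by simp [hra]) (by simp [vertices]) rfl hpH)⟩
    · exact ⟨Or.inr (key _ _ (Or.inr rfl) (by simp [hra]) (by simp [vertices]) rfl hpH), Or.inl hpH⟩
    · exact ⟨Or.inl (key _ _ (Or.inl Sym2.eq_swap) (by simp [hra.symm]) (by simp [vertices]) rfl
        hpH), Or.inr hpH⟩
    · exact ⟨Or.inr hpH, Or.inl (key _ _ (Or.inr Sym2.eq_swap) (by simp [hra.symm])
        (by simp [vertices]) rfl hpH)⟩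
  · have key : ∀ q q' : Fin m × Fin n, s(q, q') ∈ δ.horizontalEdges → q ≠ q' → q' ∈ δ.vertices →
        q'.1 = q.1 → q ∈ H → q' ∈ H := fun q q' he hne hq' hf hq =>
      mem_of_adj_of_maximal (f := Prod.fst) (G := horizontalGraph C) hH hq
        ((SimpleGraph.fromEdgeSet_adj _).2 ⟨Set.mem_biUnion hδ he, hne⟩) (hV hq') hf
    rcases hpδ with rfl | rfl | rfl | rfl
    · exact ⟨Or.inl hpH, Or.inl (key _ _ (Or.inl rfl) (by simp [hcb]) (by simp [vertices]) rfl hpH)⟩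
    · exact ⟨Or.inl (key _ _ (Or.inl Sym2.eq_swap) (by simp [hcb.symm]) (by simp [vertices]) rfl
        hpH), Or.inl hpH⟩
    · exact ⟨Or.inr (key _ _ (Or.inr rfl) (by simp [hcb]) (by simp [vertices]) rfl hpH), Or.inr hpH⟩
    · exact ⟨Or.inr hpH, Or.inr (key _ _ (Or.inr Sym2.eq_swap) (by simp [hcb.symm])
        (by simp [vertices]) rfl hpH)⟩

theorem isHomogeneous_binomial (K : Type*) [Field K] (δ : TwoMinor m n) :
    (δ.binomial K).IsHomogeneous 2 :=
  ((isHomogeneous_X K _).mul (isHomogeneous_X K _)).sub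
    ((isHomogeneous_X K _).mul (isHomogeneous_X K _))

end TwoMinor

theorem homogeneousComponent_mem_span_pow {σ K : Type*} [Field K] {A : Set (MvPolynomial σ K)}
    {k : ℕ} (hA : ∀ p ∈ A, p.IsHomogeneous k) (t : ℕ) :
    ∀ x ∈ Ideal.span A ^ t, ∀ e, homogeneousComponent e x ∈ Ideal.span A ^ t := by
  let := MvPolynomial.gradedAlgebra (σ := σ) (R := K)
  have h1 : (Ideal.span A).IsHomogeneous (homogeneousSubmodule σ K) :=
    Ideal.homogeneous_span _ _ fun p hp => ⟨k, hA p hp⟩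
  have ht : (Ideal.span A ^ t).IsHomogeneous (homogeneousSubmodule σ K) := by
    induction t with
    | zero =>
      rw [pow_zero, Ideal.one_eq_top]
      exact Ideal.IsHomogeneous.top _
    | succ t ih =>
      rw [pow_succ]
      exact ih.mul h1
  intro x hx e
  have := ht e hx
  rwa [← MvPolynomial.decomposition.decompose'_apply]

theorem TwoMinor.homogeneousComponent_mem_binomialIdeal_pow {K : Type*} [Field K]
    (C : Set (TwoMinor m n)) (t : ℕ) :
    ∀ x ∈ binomialIdeal K C ^ t, ∀ e, homogeneousComponent e x ∈ binomialIdeal K C ^ t :=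
  homogeneousComponent_mem_span_pow (k := 2) (by
    rintro _ ⟨δ, -, rfl⟩
    exact isHomogeneous_binomial K δ) t

/-- The retraction of a polynomial ring onto the polynomial subring on the variables in `U`, sending
the remaining variables to zero. -/
noncomputable def killOutside {τ : Type*} (K : Type*) [Field K] (U : Set τ) :
    MvPolynomial τ K →ₐ[K] MvPolynomial U K :=
  open Classical in aeval fun s => if h : s ∈ U then X ⟨s, h⟩ else 0

section KillOutside

variable {τ K : Type*} [Field K] {U : Set τ} {s : τ}

theorem killOutside_X_of_mem (h : s ∈ U) : killOutside K U (X s) = X ⟨s, h⟩ := by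
  simp [killOutside, h]

theorem killOutside_X_of_notMem (h : s ∉ U) : killOutside K U (X s) = 0 := by
  simp [killOutside, h]

theorem isHomogeneous_killOutside_X (s : τ) : (killOutside K U (X s)).IsHomogeneous 1 := by
  by_cases h : s ∈ U
  · rw [killOutside_X_of_mem h]
    exact isHomogeneous_X K _
  · rw [killOutside_X_of_notMem h]
    exact isHomogeneous_zero _ _ _

theorem killOutside_rename_val (p : MvPolynomial U K) :
    killOutside K U (rename (↑) p) = p := by
  have h : (killOutside K U).comp (rename (↑)) = AlgHom.id K (MvPolynomial U K) :=
    algHom_ext fun s => by simp [killOutside_X_of_mem s.2]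
  exact DFunLike.congr_fun h p

end KillOutside

namespace TwoMinor

variable {K : Type*} [Field K]

theorem rename_killOutside_binomial_of_disjoint {H : Set (Fin m × Fin n)} {δ : TwoMinor m n}
    (h : Disjoint δ.vertices H) :
    rename (↑) (killOutside K Hᶜ (δ.binomial K)) = δ.binomial K := by
  have hv : ∀ p ∈ δ.vertices, p ∈ Hᶜ := fun p hp => Set.disjoint_left.1 h hp
  simp only [binomial, map_sub, map_mul,
    killOutside_X_of_mem (hv (δ.a₁, δ.b₁) (by simp [vertices])),
    killOutside_X_of_mem (hv (δ.a₁, δ.b₂) (by simp [vertices])),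
    killOutside_X_of_mem (hv (δ.a₂, δ.b₁) (by simp [vertices])),
    killOutside_X_of_mem (hv (δ.a₂, δ.b₂) (by simp [vertices])), rename_X]

theorem killOutside_binomial_of_not_disjoint {C : Set (TwoMinor m n)} {H : Set (Fin m × Fin n)}
    (hH : IsMaximalVerticalInterval C H ∨ IsMaximalHorizontalInterval C H) {δ : TwoMinor m n}
    (hδ : δ ∈ C) (h : ¬ Disjoint δ.vertices H) : killOutside K Hᶜ (δ.binomial K) = 0 := by
  have h0 : ∀ p ∈ H, killOutside K Hᶜ (X p) = 0 := fun p hp =>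
    killOutside_X_of_notMem fun h => h hp
  obtain ⟨h1, h2⟩ := mem_of_not_disjoint_of_maximal hH hδ h
  have e1 : killOutside K Hᶜ (X (δ.a₁, δ.b₁) * X (δ.a₂, δ.b₂)) = 0 := by
    rcases h1 with h1 | h1 <;> simp [h0 _ h1]
  have e2 : killOutside K Hᶜ (X (δ.a₁, δ.b₂) * X (δ.a₂, δ.b₁)) = 0 := by
    rcases h2 with h2 | h2 <;> simp [h0 _ h2]
  rw [binomial, map_sub, e1, e2, sub_zero]

/-- Setting the variables of a maximal interval to zero turns `I(𝒞)` into the ideal of the minors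
disjoint from the interval. -/
theorem map_rename_map_killOutside_binomialIdeal {C : Set (TwoMinor m n)}
    {H : Set (Fin m × Fin n)}
    (hH : IsMaximalVerticalInterval C H ∨ IsMaximalHorizontalInterval C H) :
    ((binomialIdeal K C).map (killOutside K Hᶜ).toRingHom).map
      (rename (R := K) ((↑) : (Hᶜ : Set (Fin m × Fin n)) → Fin m × Fin n)).toRingHom =
        binomialIdeal K (removeVertices C H) := by
  apply le_antisymm
  · rw [Ideal.map_le_iff_le_comap, Ideal.map_le_iff_le_comap]
    refine Ideal.span_le.2 ?_
    rintro _ ⟨δ, hδ, rfl⟩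
    have key : rename (↑) (killOutside K Hᶜ (δ.binomial K)) ∈
        binomialIdeal K (removeVertices C H) := by
      by_cases h : Disjoint δ.vertices H
      · rw [rename_killOutside_binomial_of_disjoint h]
        exact Ideal.subset_span ⟨δ, ⟨hδ, h⟩, rfl⟩
      · rw [killOutside_binomial_of_not_disjoint hH hδ h, map_zero]
        exact Ideal.zero_mem _
    exact key
  · refine Ideal.span_le.2 ?_
    rintro _ ⟨δ, ⟨hδ, h⟩, rfl⟩
    have := Ideal.mem_map_of_mem
      (rename (R := K) ((↑) : (Hᶜ : Set (Fin m × Fin n)) → Fin m × Fin n)).toRingHom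
      (Ideal.mem_map_of_mem (killOutside K Hᶜ).toRingHom
        (Ideal.subset_span ⟨δ, hδ, rfl⟩ : δ.binomial K ∈ binomialIdeal K C))
    have e := rename_killOutside_binomial_of_disjoint (K := K) h
    change δ.binomial K ∈ _
    rw [← e]
    exact this

end TwoMinor

end Intervals

/-! ### Comparison of the Betti numbers -/

section Main

open MvPolynomial TwoMinor

/-- The graded Betti numbers of powers do not increase when the minors meeting a maximal interval
are removed. -/
theorem betti_removeVertices_le {K : Type*} [Field K] {m n : ℕ} {C : Set (TwoMinor m n)}
    {H : Set (Fin m × Fin n)}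
    (hH : IsMaximalVerticalInterval C H ∨ IsMaximalHorizontalInterval C H) (t : ℕ)
    (F : MinimalGradedFreeResolution (σ := Fin m × Fin n)
      (quotientGrading (binomialIdeal K C ^ t)))
    (F' : MinimalGradedFreeResolution (σ := Fin m × Fin n)
      (quotientGrading (binomialIdeal K (removeVertices C H) ^ t)))
    (i j : ℕ) : F'.betti i j ≤ F.betti i j := by
  let a : MvPolynomial (Hᶜ : Set (Fin m × Fin n)) K →ₐ[K] MvPolynomial (Fin m × Fin n) K :=
    rename (↑)
  let b := killOutside K Hᶜ
  let I := (binomialIdeal K C).map b.toRingHom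
  have ha : ∀ s, (a (X s)).IsHomogeneous 1 := fun s => by
    simpa [a] using isHomogeneous_X K (s : Fin m × Fin n)
  have hI : ∀ x ∈ I ^ t, ∀ e, homogeneousComponent e x ∈ I ^ t := by
    have hspan : I = Ideal.span (b.toRingHom '' ((fun δ => δ.binomial K) '' C)) :=
      Ideal.map_span _ _
    rw [hspan]
    refine homogeneousComponent_mem_span_pow (k := 2) ?_ t
    rintro _ ⟨_, ⟨δ, -, rfl⟩, rfl⟩
    exact isHomogeneous_map_of_forall_X isHomogeneous_killOutside_X (isHomogeneous_binomial K δ)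
  have hmap : I.map a.toRingHom = binomialIdeal K (removeVertices C H) :=
    map_rename_map_killOutside_binomialIdeal hH
  have hle : binomialIdeal K (removeVertices C H) ≤ binomialIdeal K C :=
    Ideal.span_mono (Set.image_mono fun δ hδ => hδ.1)
  -- `G` resolves `R / I ^ t` over `R = K[x_p : p ∉ H]`, an algebra retract of `S / I(𝒞) ^ t`.
  obtain ⟨G⟩ := nonempty_minimalGradedFreeResolution (I ^ t) hI
  have hGF : G.betti i j ≤ F.betti i j := by
    refine G.betti_le_of_retract a b ha isHomogeneous_killOutside_X killOutside_rename_val hI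
      (homogeneousComponent_mem_binomialIdeal_pow C t) ?_ ?_ F i j
    · rw [← Ideal.map_le_iff_le_comap, Ideal.map_pow, hmap]
      exact Ideal.pow_right_mono hle t
    · rw [← Ideal.map_le_iff_le_comap, Ideal.map_pow]
  let : Algebra (MvPolynomial (Hᶜ : Set (Fin m × Fin n)) K) (MvPolynomial (Fin m × Fin n) K) :=
    a.toRingHom.toAlgebra
  obtain ⟨B⟩ := exists_basis_over_rename_val (K := K) (Hᶜ : Set (Fin m × Fin n))
  obtain ⟨E, hE⟩ := exists_resolution_baseChange B a (fun _ => rfl) ha G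
  have hpow : (I ^ t).map (algebraMap (MvPolynomial (Hᶜ : Set (Fin m × Fin n)) K)
      (MvPolynomial (Fin m × Fin n) K)) = binomialIdeal K (removeVertices C H) ^ t := by
    rw [Ideal.map_pow]
    exact congrArg (· ^ t) hmap
  -- `E` and `F'` resolve the same module, so the retract inequality along the identity compares
  -- their Betti numbers.
  have hid : ∀ s, (AlgHom.id K (MvPolynomial (Fin m × Fin n) K) (X s)).IsHomogeneous 1 :=
    fun s => isHomogeneous_X K s
  have hF'E : F'.betti i j ≤ E.betti i j :=
    F'.betti_le_of_retract (AlgHom.id K _) (AlgHom.id K _) hid hid (fun _ => rfl)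
      (homogeneousComponent_mem_binomialIdeal_pow _ t)
      (hpow ▸ homogeneousComponent_mem_binomialIdeal_pow _ t) hpow.ge hpow.le E i j
  exact (hF'E.trans (hE i j).le).trans hGF

end Main

theorem mainTheorem10 {K : Type*} [Field K] {m n : ℕ} (C : Set (TwoMinor m n))
    (hC : ∀ δ ∈ C, δ.IsCornerInterval) (H : Set (Fin m × Fin n))
    (hH : TwoMinor.IsMaximalVerticalInterval C H ∨ TwoMinor.IsMaximalHorizontalInterval C H)
    (C' : Set (TwoMinor m n)) (hC' : C' = TwoMinor.removeVertices C H)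
    (t : ℕ) (ht : 1 ≤ t) :
    Nonempty (MinimalGradedFreeResolution (σ := Fin m × Fin n)
      (quotientGrading (TwoMinor.binomialIdeal K C ^ t))) ∧
    Nonempty (MinimalGradedFreeResolution (σ := Fin m × Fin n)
      (quotientGrading (TwoMinor.binomialIdeal K C' ^ t))) ∧
    ∀ (F : MinimalGradedFreeResolution (σ := Fin m × Fin n)
        (quotientGrading (TwoMinor.binomialIdeal K C ^ t)))
      (F' : MinimalGradedFreeResolution (σ := Fin m × Fin n)
        (quotientGrading (TwoMinor.binomialIdeal K C' ^ t)))
      (i j : ℕ), F'.betti i j ≤ F.betti i j := by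
  subst hC'
  exact ⟨nonempty_minimalGradedFreeResolution _
      (TwoMinor.homogeneousComponent_mem_binomialIdeal_pow C t),
    nonempty_minimalGradedFreeResolution _
      (TwoMinor.homogeneousComponent_mem_binomialIdeal_pow _ t),
    betti_removeVertices_le hH t⟩
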